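/- Let $X$ be a compact complex manifold and let $\pi : L \to X$ be a holomorphic line bundle with dual bundle $L^*$. Let $H^0(X,L^*)$ be the complex vector space of global holomorphic sections of $L^*$. It is finite-dimensional; let $h = \dim_{\mathbb C} H^0(X,L^*)$. For $s \in H^0(X,L^*)$ and a vector $v$ in the total space of $L$ write $s[v] = s(\pi(v))(v) \in \mathbb C$. For an integer $k \ge 0$ define $$\Sigma^k s : L^k \to \mathbb C, \qquad (\Sigma^k s)(v_1,\dots,v_k) = \sum_{j=1}^k s[v_j],$$ on $k$-tuples of points of the total space of $L$, and let $$V(\Sigma^k s) = \{(v_1,\dots,v_k) \in L^k : (\Sigma^k s)(v_1,\dots,v_k) = 0\}$$ be its zero variety. Let $g, s_1,\dots,s_N \in H^0(X,L^*)$ and suppose that $$\bigcap_{j=1}^N V(\Sigma^h s_j) \subset V(\Sigma^h g)$$ (an empty intersection, when $N = 0$, means all of $L^h$). Then $g$ is a linear combination of $s_1,\dots,s_N$, i.e. $g = \sum_{j=1}^N c_j s_j$ for some $c_1,\dots,c_N \in \mathbb C$. -/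

import Mathlib

open scoped Manifold Bundle ContDiff

noncomputable section

/-- For a function `f : Y → G` into an additive abelian group, the function
`Σ^k f : Y^k → G`, `(z₁, …, z_k) ↦ f z₁ + ⋯ + f z_k`. -/
def sigmaSum {Y G : Type*} [AddCommGroup G] (k : ℕ) (f : Y → G) : (Fin k → Y) → G :=
  fun z => ∑ i, f (z i)

section LineBundle

variable {E : Type*} [NormedAddCommGroup E] [NormedSpace ℂ E]
  {X : Type*} [TopologicalSpace X] [ChartedSpace E X]
  (L : X → Type*) [∀ x, AddCommGroup (L x)] [∀ x, Module ℂ (L x)]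
  [∀ x, TopologicalSpace (L x)] [TopologicalSpace (Bundle.TotalSpace ℂ L)]
  [FiberBundle ℂ L] [VectorBundle ℂ ℂ L]

/-- The fibres of the dual bundle `L*` of a complex line bundle `L`: it is the bundle of
homomorphisms from `L` to the trivial line bundle, with Mathlib's bundle structure. -/
abbrev DualBundle : X → Type _ := fun x => L x →L[ℂ] Bundle.Trivial X ℂ x

variable (E) in
/-- `H⁰(X, L*)`: the complex vector space of global holomorphic (complex analytic) sections of
the dual bundle `L*`. -/
abbrev H0Dual : Type _ :=
  ContMDiffSection 𝓘(ℂ, E) (ℂ →L[ℂ] ℂ) ω (DualBundle L)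

variable {L}

/-- The pairing `s[v] = s(π(v))(v)` of a section `s` of `L*` with a vector `v` of the total
space of `L`. -/
def pairing (s : H0Dual E L) (v : Bundle.TotalSpace ℂ L) : ℂ :=
  (s v.proj : L v.proj →L[ℂ] ℂ) v.snd

/-- The zero variety in `L^k` of the function `Σ^k s : L^k → ℂ`,
`(v₁, …, v_k) ↦ s[v₁] + ⋯ + s[v_k]`. -/
def zeroVariety (k : ℕ) (s : H0Dual E L) : Set (Fin k → Bundle.TotalSpace ℂ L) :=
  {v | sigmaSum k (pairing s) v = 0}

end LineBundle

end

/-! Each vector of `L` gives a functional `s ↦ s[v]` on `H⁰(X, L*)`. These functionals are closed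
under scaling and only the zero section is killed by all of them, so they span the dual, of
dimension `h`. Hence every functional is a sum of `h` of them, that is, `s ↦ (Σ^h s)(v)` for some `v
∈ L^h`. If `g` were outside the span of the `s_j`, a functional killing every `s_j` but not `g`
would give a point violating the inclusion.

Finite-dimensionality comes from the Schwarz lemma: a section vanishing on a suitable finite set has
its local sup bound halved repeatedly, so it is zero. -/

open Bundle Set Metric Filter Topology in
/-- Around every point of an open set `U` of a complex manifold there are compact sets `K ⊆ K'`
such that a holomorphic function on `U` which vanishes on a sufficiently fine finite subset of `K`
is on `K` much smaller than on `K'`. -/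
theorem exists_compact_nhds_small_of_eq_zero_on_finite
    {E : Type*} [NormedAddCommGroup E] [NormedSpace ℂ E] [FiniteDimensional ℂ E]
    {X : Type*} [TopologicalSpace X] [ChartedSpace E X] [IsManifold 𝓘(ℂ, E) ω X]
    {U : Set X} (hU : IsOpen U) {x : X} (hx : x ∈ U) :
    ∃ K K' : Set X, K ∈ 𝓝 x ∧ IsCompact K ∧ IsCompact K' ∧ K ⊆ U ∧ K' ⊆ U ∧
      ∀ ε > 0, ∃ P : Set X, P.Finite ∧ P ⊆ K ∧ ∀ f : X → ℂ,
        MDifferentiableOn 𝓘(ℂ, E) 𝓘(ℂ, ℂ) f U → (∀ p ∈ P, f p = 0) →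
        ∀ M, (∀ y ∈ K', ‖f y‖ ≤ M) → ∀ y ∈ K, ‖f y‖ ≤ ε * M := by
  have : ProperSpace E := FiniteDimensional.proper ℂ E
  set φ := extChartAt 𝓘(ℂ, E) x with hφ
  have hcont : ContinuousOn φ.symm φ.target := continuousOn_extChartAt_symm x
  have hopen : IsOpen (φ.target ∩ φ.symm ⁻¹' U) :=
    hcont.isOpen_inter_preimage (isOpen_extChartAt_target x) hU
  have hmem : φ x ∈ φ.target ∩ φ.symm ⁻¹' U :=
    ⟨mem_extChartAt_target x, by simpa [hφ] using hx⟩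
  obtain ⟨ρ, hρ, hball⟩ := Metric.nhds_basis_closedBall.mem_iff.1 (hopen.mem_nhds hmem)
  obtain ⟨r, hr, rfl⟩ : ∃ r > 0, 2 * r = ρ := ⟨ρ / 2, by positivity, by ring⟩
  have hsub : closedBall (φ x) r ⊆ closedBall (φ x) (2 * r) :=
    closedBall_subset_closedBall (by linarith)
  have hU' : ∀ R ≤ 2 * r, φ.symm '' closedBall (φ x) R ⊆ U := by
    rintro R hR _ ⟨z, hz, rfl⟩
    exact (hball (closedBall_subset_closedBall hR hz)).2
  have hK : ∀ R ≤ 2 * r, IsCompact (φ.symm '' closedBall (φ x) R) := fun R hR ↦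
    (isCompact_closedBall _ _).image_of_continuousOn
      (hcont.mono fun z hz ↦ (hball (closedBall_subset_closedBall hR hz)).1)
  refine ⟨φ.symm '' closedBall (φ x) r, φ.symm '' closedBall (φ x) (2 * r), ?_,
    hK _ (by linarith), hK _ le_rfl, hU' _ (by linarith), hU' _ le_rfl, fun ε hε ↦ ?_⟩
  · filter_upwards [extChartAt_source_mem_nhds (I := 𝓘(ℂ, E)) x,
      (continuousAt_extChartAt (I := 𝓘(ℂ, E)) x).preimage_mem_nhds (closedBall_mem_nhds _ hr)]
      with y hy hy'
    exact ⟨φ y, hy', φ.left_inv hy⟩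
  · have hδ : 0 < min r (ε * r) := by positivity
    obtain ⟨P, hPK, hPfin, hP⟩ :=
      (isCompact_closedBall (φ x) r).finite_cover_balls hδ
    refine ⟨φ.symm '' P, hPfin.image _, image_mono hPK, ?_⟩
    rintro f hf hfP M hM _ ⟨z, hz, rfl⟩
    obtain ⟨p, hpP, hzp⟩ := mem_iUnion₂.1 (hP hz)
    have hpb : ball p r ⊆ closedBall (φ x) (2 * r) := by
      intro w hw
      have h1 := mem_closedBall.1 (hPK hpP)
      have h2 := mem_ball.1 hw
      rw [mem_closedBall]
      linarith [dist_triangle w p (φ x)]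
    have hd : DifferentiableOn ℂ (f ∘ φ.symm) (ball p r) := by
      rw [← mdifferentiableOn_iff_differentiableOn]
      exact hf.comp (mdifferentiableOn_extChartAt_symm.mono
        fun w hw ↦ (hball (hpb hw)).1) fun w hw ↦ (hball (hpb hw)).2
    have hp0 : (f ∘ φ.symm) p = 0 := hfP _ ⟨p, hpP, rfl⟩
    have hmaps : MapsTo (f ∘ φ.symm) (ball p r) (closedBall ((f ∘ φ.symm) p) M) := by
      intro w hw
      rw [hp0, mem_closedBall_zero_iff]
      exact hM _ ⟨w, hpb hw, rfl⟩
    have hM0 : 0 ≤ M := (norm_nonneg _).trans (hM _ ⟨z, hsub hz, rfl⟩)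
    have hzp' := mem_ball.1 hzp
    have key := Complex.dist_le_div_mul_dist_of_mapsTo_ball hd hmaps
      (mem_ball.2 (hzp'.trans_le (min_le_left _ _)))
    rw [hp0, dist_zero_right] at key
    refine key.trans ?_
    have h2 : dist z p ≤ ε * r := (hzp'.trans_le (min_le_right _ _)).le
    calc M / r * dist z p ≤ M / r * (ε * r) := by gcongr
      _ = ε * M := by field_simp

section Transition

variable {X : Type*} [TopologicalSpace X] {L : X → Type*}
  [∀ x, AddCommGroup (L x)] [∀ x, Module ℂ (L x)]
  [∀ x, TopologicalSpace (L x)] [TopologicalSpace (Bundle.TotalSpace ℂ L)]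
  [FiberBundle ℂ L] [VectorBundle ℂ ℂ L]

/-- In a line bundle, every vector is a multiple of the local frame given by a trivialization. -/
theorem Bundle.Trivialization.eq_smul_symm_one
    (e : Bundle.Trivialization ℂ (Bundle.TotalSpace.proj : Bundle.TotalSpace ℂ L → X))
    [MemTrivializationAtlas e] {y : X} (hy : y ∈ e.baseSet) (w : L y) :
    w = (e ⟨y, w⟩).2 • e.symm y 1 := by
  have h := (e.symmₗ ℂ y).map_smul (e ⟨y, w⟩).2 1
  rw [smul_eq_mul, mul_one, e.coe_symmₗ hy, e.symm_apply_apply_mk hy] at h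
  exact h

/-- On compact sets, the local frames given by two trivializations of a line bundle differ by a
bounded factor. -/
theorem exists_forall_norm_symm_le [T2Space X]
    (e e' : Bundle.Trivialization ℂ (Bundle.TotalSpace.proj : Bundle.TotalSpace ℂ L → X))
    [MemTrivializationAtlas e] [MemTrivializationAtlas e'] {K K' : Set X}
    (hK : IsCompact K) (hK' : IsCompact K') (hKe : K ⊆ e.baseSet) (hKe' : K' ⊆ e'.baseSet) :
    ∃ C : ℝ, ∀ y ∈ K, y ∈ K' → ∀ l : L y →ₗ[ℂ] ℂ,
      ‖l (e'.symm y 1)‖ ≤ C * ‖l (e.symm y 1)‖ := by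
  have hc : ContinuousOn (fun y ↦ e'.coordChangeL ℂ e y 1) (K ∩ K') :=
    ((continuousOn_coordChange ℂ e' e).mono fun y hy ↦ ⟨hKe' hy.2, hKe hy.1⟩).clm_apply
      continuousOn_const
  obtain ⟨C, hC⟩ := (hK.inter hK').exists_bound_of_continuousOn hc
  refine ⟨C, fun y hy hy' l ↦ ?_⟩
  rw [e.eq_smul_symm_one (hKe hy) (e'.symm y 1), ← e'.coordChangeL_apply (R := ℂ) e ⟨hKe' hy', hKe hy⟩,
    map_smul, norm_smul]
  gcongr
  exact hC y ⟨hy, hy'⟩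

end Transition

section Sections

variable {E : Type*} [NormedAddCommGroup E] [NormedSpace ℂ E]
  {X : Type*} [TopologicalSpace X] [ChartedSpace E X]
  {L : X → Type*} [∀ x, AddCommGroup (L x)] [∀ x, Module ℂ (L x)]
  [∀ x, TopologicalSpace (L x)] [TopologicalSpace (Bundle.TotalSpace ℂ L)]
  [FiberBundle ℂ L] [VectorBundle ℂ ℂ L]

/-- The pairing with a fixed vector, as a linear functional on sections. -/
noncomputable def pairingAt (v : Bundle.TotalSpace ℂ L) : H0Dual E L →ₗ[ℂ] ℂ where
  toFun s := pairing s v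
  map_add' _ _ := rfl
  map_smul' _ _ := rfl

theorem pairing_smul (s : H0Dual E L) (c : ℂ) (v : Bundle.TotalSpace ℂ L) :
    pairing s ⟨v.proj, c • v.snd⟩ = c * pairing s v :=
  map_smul (s v.proj : L v.proj →L[ℂ] ℂ) c v.snd

theorem H0Dual.eq_zero_of_pairing_eq_zero {s : H0Dual E L} (hs : ∀ v, pairing s v = 0) :
    s = 0 := by
  refine ContMDiffSection.ext fun x ↦ ContinuousLinearMap.ext fun w ↦ ?_
  exact hs ⟨x, w⟩

/-- A section of the dual bundle is holomorphic when read in a local frame. -/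
theorem H0Dual.mdifferentiableOn_symm [IsManifold 𝓘(ℂ, E) ω X]
    [ContMDiffVectorBundle ω ℂ L 𝓘(ℂ, E)]
    (s : H0Dual E L)
    (e : Bundle.Trivialization ℂ (Bundle.TotalSpace.proj : Bundle.TotalSpace ℂ L → X))
    [MemTrivializationAtlas e] :
    MDifferentiableOn 𝓘(ℂ, E) 𝓘(ℂ, ℂ) (fun y ↦ pairing s ⟨y, e.symm y 1⟩) e.baseSet := by
  have hframe : ContMDiffOn 𝓘(ℂ, E) (𝓘(ℂ, E).prod 𝓘(ℂ, ℂ)) ω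
      (fun y ↦ Bundle.TotalSpace.mk' ℂ y (e.symm y 1)) e.baseSet :=
    e.contMDiffOn_section_baseSet_iff.2 <| (contMDiffOn_const (c := (1 : ℂ))).congr fun y hy ↦ by
      rw [e.apply_mk_symm hy]
  intro x hx
  have h := (s.contMDiff.contMDiffAt.contMDiffWithinAt).clm_bundle_apply (hframe x hx)
  rw [Bundle.contMDiffWithinAt_section] at h
  exact h.mdifferentiableWithinAt (by simp)

/-- The space of holomorphic sections of the dual of a line bundle on a compact complex manifold
is finite-dimensional. -/
theorem H0Dual.finiteDimensional [FiniteDimensional ℂ E] [T2Space X] [CompactSpace X]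
    [IsManifold 𝓘(ℂ, E) ω X] [ContMDiffVectorBundle ω ℂ L 𝓘(ℂ, E)] :
    FiniteDimensional ℂ (H0Dual E L) := by
  let e : ∀ x : X, Bundle.Trivialization ℂ (Bundle.TotalSpace.proj : Bundle.TotalSpace ℂ L → X) :=
    fun x ↦ trivializationAt ℂ L x
  choose K K' hKx hK hK' hKU hKU' hP using fun x : X ↦
    exists_compact_nhds_small_of_eq_zero_on_finite (E := E) (e x).open_baseSet
      (FiberBundle.mem_baseSet_trivializationAt' x)
  obtain ⟨t, -, ht⟩ := isCompact_univ.elim_nhds_subcover K fun x _ ↦ hKx x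
  choose C hC using fun i j ↦ exists_forall_norm_symm_le (e i) (e j) (hK i) (hK' j)
    (hKU i) (hKU' j)
  obtain ⟨D, hD⟩ := ((t ×ˢ t).image fun p ↦ C p.1 p.2).exists_le
  replace hD : ∀ i ∈ t, ∀ j ∈ t, C i j ≤ max D 1 := fun i hi j hj ↦
    (hD _ (Finset.mem_image.2 ⟨(i, j), Finset.mk_mem_product hi hj, rfl⟩)).trans (le_max_left _ _)
  have hD0 : 0 < max D 1 := by positivity
  -- This `ε` absorbs the frame-change factor, at most `max D 1`, and leaves a contraction by `1 /
  -- 2`.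
  choose P hPfin _ hP using fun x ↦ hP x (1 / (2 * max D 1)) (by positivity)
  have hfin : ∀ i, Finite (P i) := fun i ↦ (hPfin i)
  let Φ : H0Dual E L →ₗ[ℂ] ((Σ i : t, P i) → ℂ) :=
    LinearMap.pi fun a ↦ pairingAt ⟨a.2, (e a.1).symm a.2 1⟩
  refine FiniteDimensional.of_injective Φ ((injective_iff_map_eq_zero Φ).2 fun s hs ↦ ?_)
  have hs0 : ∀ i ∈ t, ∀ p ∈ P i, pairing s ⟨p, (e i).symm p 1⟩ = 0 := fun i hi p hp ↦
    congrFun hs ⟨⟨i, hi⟩, ⟨p, hp⟩⟩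
  have hstep : ∀ M : ℝ, (∀ i ∈ t, ∀ y ∈ K' i, ‖pairing s ⟨y, (e i).symm y 1⟩‖ ≤ M) →
      ∀ i ∈ t, ∀ y ∈ K' i, ‖pairing s ⟨y, (e i).symm y 1⟩‖ ≤ 1 / 2 * M := by
    intro M hM j hj y hy
    -- The estimate is made in a frame `i` with `y ∈ K i`, then carried over to frame `j`.
    obtain ⟨i, hi, hyi⟩ := Set.mem_iUnion₂.1 (ht (Set.mem_univ y))
    have h1 := hC i j y hyi hy (s y : L y →L[ℂ] ℂ).toLinearMap
    have h2 := hP i _ (s.mdifferentiableOn_symm (e i)) (hs0 i hi) M (hM i hi) y hyi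
    calc ‖pairing s ⟨y, (e j).symm y 1⟩‖
        ≤ C i j * ‖pairing s ⟨y, (e i).symm y 1⟩‖ := h1
      _ ≤ max D 1 * (1 / (2 * max D 1) * M) := by gcongr; exact hD i hi j hj
      _ = 1 / 2 * M := by field_simp
  have hbound : ∃ M : ℝ, ∀ i ∈ t, ∀ y ∈ K' i, ‖pairing s ⟨y, (e i).symm y 1⟩‖ ≤ M := by
    choose B hB using fun i ↦ (hK' i).exists_bound_of_continuousOn
      ((s.mdifferentiableOn_symm (e i)).continuousOn.mono (hKU' i))
    obtain ⟨M, hM⟩ := (t.image B).exists_le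
    exact ⟨M, fun i hi y hy ↦ (hB i y hy).trans (hM _ (Finset.mem_image_of_mem B hi))⟩
  obtain ⟨M, hM⟩ := hbound
  have hpow : ∀ n : ℕ, ∀ i ∈ t, ∀ y ∈ K' i,
      ‖pairing s ⟨y, (e i).symm y 1⟩‖ ≤ (1 / 2) ^ n * M := by
    intro n
    induction n with
    | zero => simpa using hM
    | succ n ih => simpa [pow_succ', mul_assoc] using hstep _ ih
  have hlim : Filter.Tendsto (fun n : ℕ ↦ (1 / 2 : ℝ) ^ n * M) Filter.atTop (nhds 0) := by
    simpa using (tendsto_pow_atTop_nhds_zero_of_lt_one (r := (1 / 2 : ℝ)) (by norm_num)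
      (by norm_num)).mul_const M
  have hzero : ∀ i ∈ t, ∀ y ∈ K' i, pairing s ⟨y, (e i).symm y 1⟩ = 0 := fun i hi y hy ↦
    norm_le_zero_iff.1 (ge_of_tendsto' hlim fun n ↦ hpow n i hi y hy)
  refine H0Dual.eq_zero_of_pairing_eq_zero fun ⟨y, w⟩ ↦ ?_
  obtain ⟨i, hi, hyi⟩ := Set.mem_iUnion₂.1 (ht (Set.mem_univ y))
  -- The estimate with `M = 0` carries vanishing from `K' i` to `K i`.
  have hy0 : pairing s ⟨y, (e i).symm y 1⟩ = 0 := norm_le_zero_iff.1 <| by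
    simpa using hP i _ (s.mdifferentiableOn_symm (e i)) (hs0 i hi) 0
      (fun z hz ↦ (norm_le_zero_iff.2 (hzero i hi z hz))) y hyi
  have hw : w = ((e i) ⟨y, w⟩).2 • (e i).symm y 1 :=
    (e i).eq_smul_symm_one (hKU i hyi) w
  have := pairing_smul s ((e i) ⟨y, w⟩).2 ⟨y, (e i).symm y 1⟩
  rw [hy0, mul_zero] at this
  rw [hw]
  exact this

end Sections

/-- A set spanning a vector space of dimension `h` and closed under scalar multiplication contains,
for each vector, `h` elements with that vector as their sum. -/
theorem exists_sum_eq_of_span_eq_top {K V : Type*} [Field K] [AddCommGroup V] [Module K V]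
    [FiniteDimensional K V] {h : ℕ} (hV : Module.finrank K V = h) {S : Set V} (hS : Submodule.span K S = ⊤)
    (hsmul : ∀ (c : K), ∀ v ∈ S, c • v ∈ S) (ξ : V) :
    ∃ w : Fin h → V, (∀ i, w i ∈ S) ∧ ∑ i, w i = ξ := by
  obtain ⟨b, hbS, hb, hli⟩ := exists_linearIndependent K S
  rw [hS] at hb
  let B := Module.Basis.mk hli (by simp [hb])
  have : Fintype b := FiniteDimensional.fintypeBasisIndex B
  let σ : Fin h ≃ b :=
    Fintype.equivOfCardEq (by rw [Fintype.card_fin, ← hV, Module.finrank_eq_card_basis B])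
  -- Zero coordinates are kept as summands, so there are exactly `h` terms.
  refine ⟨fun i ↦ B.repr ξ (σ i) • B (σ i), fun i ↦ hsmul _ _ ?_, ?_⟩
  · simpa [B] using hbS (σ i).2
  · rw [σ.sum_comp fun j ↦ B.repr ξ j • B j, B.sum_repr]

theorem proposition3
    {E : Type*} [NormedAddCommGroup E] [NormedSpace ℂ E] [FiniteDimensional ℂ E]
    {X : Type*} [TopologicalSpace X] [T2Space X] [CompactSpace X]
    [ChartedSpace E X] [IsManifold 𝓘(ℂ, E) ω X]
    (L : X → Type*) [∀ x, AddCommGroup (L x)] [∀ x, Module ℂ (L x)]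
    [∀ x, TopologicalSpace (L x)] [TopologicalSpace (Bundle.TotalSpace ℂ L)]
    [FiberBundle ℂ L] [VectorBundle ℂ ℂ L] [ContMDiffVectorBundle ω ℂ L 𝓘(ℂ, E)] :
    FiniteDimensional ℂ (H0Dual E L) ∧
      ∀ (h : ℕ), h = Module.finrank ℂ (H0Dual E L) →
        ∀ (N : ℕ) (s : Fin N → H0Dual E L) (g : H0Dual E L),
          (⋂ j, zeroVariety h (s j)) ⊆ zeroVariety h g →
            ∃ c : Fin N → ℂ, g = ∑ j, c j • s j := by
  refine ⟨H0Dual.finiteDimensional, ?_⟩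
  rintro h rfl N s g hsub
  have := H0Dual.finiteDimensional (E := E) (L := L)
  suffices hg : g ∈ Submodule.span ℂ (Set.range s) by
    obtain ⟨c, hc⟩ := (Submodule.mem_span_range_iff_exists_fun ℂ).1 hg
    exact ⟨c, hc.symm⟩
  by_contra hg
  obtain ⟨ξ, hξg, hξ⟩ := Submodule.exists_le_ker_of_notMem hg
  have hspan : Submodule.span ℂ
      (Set.range (pairingAt : Bundle.TotalSpace ℂ L → Module.Dual ℂ (H0Dual E L))) = ⊤ := by
    -- In finite dimension a subspace of the dual is everything once its common kernel is zero.
    rw [← Subspace.dualCoannihilator_dualAnnihilator_eq (W := Submodule.span ℂ _),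
      Submodule.dualAnnihilator_eq_top_iff, eq_bot_iff]
    intro s hs
    rw [Submodule.mem_dualCoannihilator] at hs
    exact H0Dual.eq_zero_of_pairing_eq_zero fun v ↦ hs _ (Submodule.subset_span ⟨v, rfl⟩)
  obtain ⟨w, hwS, hw⟩ := exists_sum_eq_of_span_eq_top Subspace.dual_finrank_eq hspan (by
    rintro c _ ⟨v, rfl⟩
    exact ⟨⟨v.proj, c • v.snd⟩, LinearMap.ext fun s ↦ pairing_smul s c v⟩) ξ
  choose v hv using hwS
  have hsum : ∀ f, sigmaSum _ (pairing f) v = ξ f := fun f ↦ by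
    rw [← hw, LinearMap.sum_apply]
    exact Finset.sum_congr rfl fun i _ ↦ by rw [← hv i]; rfl
  refine hξg ((hsum g).symm.trans (hsub (Set.mem_iInter.2 fun j ↦ (hsum (s j)).trans ?_)))
  exact hξ (Submodule.subset_span ⟨j, rfl⟩)
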